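/- Let $n\ge 1$, let $x_1<x_2<\cdots<x_n$ be real numbers and let $m_1,\dots,m_n>0$. Consider the discrete cubic string with Neumann-like boundary conditions \[ -\phi'''(x)=z\,m(x)\,\phi(x)\quad (x\in\mathbf R),\qquad m=2\sum_{k=1}^n m_k\,\delta_{x_k}, \] \[ \lim_{x\to-\infty}\phi'(x)=\lim_{x\to-\infty}\phi''(x)=0,\qquad \lim_{x\to+\infty}\phi''(x)=0 , \] where the equation is understood in the sense of distributions for continuous $\phi:\mathbf R\to\mathbf C$, that is, \[ \int_{\mathbf R}\phi\,\psi'''\,dx=2z\sum_{k=1}^n m_k\,\phi(x_k)\,\psi(x_k)\quad\text{for all }\psi\in C_c^\infty(\mathbf R;\mathbf C). \] A number $z\in\mathbf C$ is called an eigenvalue if there is a solution $\phi$ of this problem that is not identically zero. Then the set of all complex eigenvalues consists of exactly $n$ distinct numbers, all of them real and nonnegative: \[ 0=\lambda_0<\lambda_1<\cdots<\lambda_{n-1}. \] -/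

import Mathlib

open MeasureTheory Filter Topology
open scoped ContDiff

namespace CubicString

/-- `φ` is a solution on the whole line of the cubic string equation `-φ''' = z m φ`, where the
mass distribution `m` is a measure. The equation holds in the sense of distributions; `φ` is
continuous, so that the product `m φ` makes sense. Moving three derivatives to the test function
`ψ` turns the pairing of `-φ'''` with `ψ` into the integral of `φ ψ'''`. -/
structure IsSolution (m : Measure ℝ) (z : ℂ) (φ : ℝ → ℂ) : Prop where
  continuous : Continuous φ
  weak_eq : ∀ ψ : ℝ → ℂ, ContDiff ℝ ∞ ψ → HasCompactSupport ψ →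
    ∫ x, φ x * iteratedDeriv 3 ψ x = z * ∫ x, φ x * ψ x ∂m

/-- The Neumann-like boundary conditions `φ_x(-∞) = φ_xx(-∞) = 0` and `φ_xx(∞) = 0`. -/
structure NeumannLike (φ : ℝ → ℂ) : Prop where
  deriv_atBot : Tendsto (deriv φ) atBot (𝓝 0)
  deriv_two_atBot : Tendsto (iteratedDeriv 2 φ) atBot (𝓝 0)
  deriv_two_atTop : Tendsto (iteratedDeriv 2 φ) atTop (𝓝 0)

/-- `z` is an eigenvalue of the cubic string with mass distribution `m` and Neumann-like boundary
conditions: the boundary value problem has a solution which is not identically zero. -/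
def IsEigenvalue (m : Measure ℝ) (z : ℂ) : Prop :=
  ∃ φ : ℝ → ℂ, φ ≠ 0 ∧ IsSolution m z φ ∧ NeumannLike φ

/-- The discrete mass distribution `2 ∑ m_k δ(x - x_k)`, for positive `m_k`. -/
noncomputable def discreteMass {n : ℕ} (x m : Fin n → ℝ) : Measure ℝ :=
  ∑ k, ENNReal.ofReal (2 * m k) • Measure.dirac (x k)

end CubicString

/-! Away from the masses a solution is quadratic. Those with `φ'(-∞) = φ''(-∞) = 0` are multiples of
the one with `φ(-∞) = 1`, namely `φ(t) = 1 - ∑ z m_k φ(x_k) (t - x_k)₊²`. Its values at the masses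
are real polynomials in `w = -z`, and the remaining condition `φ''(+∞) = 0` says that `curvPoly`
vanishes at `-z` (`isEigenvalue_iff`).

It remains to see that `curvPoly x m n` has `n` simple zeros, all real, with 0 the largest. Degree
and sign follow from positivity in the recursion. Reality and simplicity both come from
`IsInterlacingForm.valuePoly_curvPoly_pos`, an inequality for an abstract bilinear form `B`. If `B`
is `Im (g * conj f)` at a point of the upper half-plane, a zero of `curvPoly` there would make `B`
vanish; if `B` is the Wronskian at a real point, a double zero would. One induction thus serves both
purposes. -/

namespace CubicString

open Polynomial

/-! ### Transfer polynomials and their recursions -/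

/-- The values at the points `x j` of the solution of the cubic string with `φ(-∞) = 1` and
`φ'(-∞) = φ''(-∞) = 0`, as polynomials in `w = -z`. -/
noncomputable def valuePoly (x m : ℕ → ℝ) (j : ℕ) : ℝ[X] :=
  1 + X * ∑ k : Fin j, C (m k * (x j - x k) ^ 2) * valuePoly x m k
decreasing_by exact k.2

/-- Half of the first derivative at `x j` of the solution with values `valuePoly`. -/
noncomputable def slopePoly (x m : ℕ → ℝ) (j : ℕ) : ℝ[X] :=
  X * ∑ k ∈ Finset.range j, C (m k * (x j - x k)) * valuePoly x m k

/-- Half of the second derivative to the right of the first `n` masses of the solution with values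
`valuePoly`. -/
noncomputable def curvPoly (x m : ℕ → ℝ) (n : ℕ) : ℝ[X] :=
  X * ∑ k ∈ Finset.range n, C (m k) * valuePoly x m k

section

variable {x m : ℕ → ℝ}

theorem valuePoly_eq (x m : ℕ → ℝ) (j : ℕ) : valuePoly x m j =
    1 + X * ∑ k ∈ Finset.range j, C (m k * (x j - x k) ^ 2) * valuePoly x m k := by
  rw [valuePoly, Finset.sum_range]

theorem valuePoly_zero : valuePoly x m 0 = 1 := by rw [valuePoly_eq]; simp

theorem slopePoly_zero : slopePoly x m 0 = 0 := by simp [slopePoly]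

theorem curvPoly_succ (n : ℕ) :
    curvPoly x m (n + 1) = curvPoly x m n + m n • (X * valuePoly x m n) := by
  rw [curvPoly, Finset.sum_range_succ, mul_add, ← curvPoly, smul_eq_C_mul]; ring

theorem slopePoly_succ (j : ℕ) : slopePoly x m (j + 1) =
    slopePoly x m j + (x (j + 1) - x j) • curvPoly x m (j + 1) := by
  -- The extra term `k = j` vanishes, which lets all sums run over the same range.
  have h : slopePoly x m j =
      X * ∑ k ∈ Finset.range (j + 1), C (m k * (x j - x k)) * valuePoly x m k := by
    rw [Finset.sum_range_succ]; simp [slopePoly]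
  rw [h, slopePoly, curvPoly, smul_eq_C_mul, mul_left_comm, ← mul_add,
    Finset.mul_sum _ _ (C (x (j + 1) - x j)), ← Finset.sum_add_distrib]
  congr 1
  refine Finset.sum_congr rfl fun k _ => ?_
  simp only [map_mul, map_sub]; ring

/-- The trapezoidal rule for `φ'`, exact because `φ` is quadratic between masses. Averaging the two
slopes suits the positivity induction. -/
theorem valuePoly_succ (j : ℕ) : valuePoly x m (j + 1) = valuePoly x m j +
    (x (j + 1) - x j) • slopePoly x m j + (x (j + 1) - x j) • slopePoly x m (j + 1) := by
  have h : slopePoly x m j =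
      X * ∑ k ∈ Finset.range (j + 1), C (m k * (x j - x k)) * valuePoly x m k := by
    rw [Finset.sum_range_succ]; simp [slopePoly]
  have h' : valuePoly x m j =
      1 + X * ∑ k ∈ Finset.range (j + 1), C (m k * (x j - x k) ^ 2) * valuePoly x m k := by
    rw [Finset.sum_range_succ, sub_self]; simpa using valuePoly_eq x m j
  rw [valuePoly_eq, h, h', slopePoly, smul_eq_C_mul, smul_eq_C_mul, mul_left_comm (C _) X,
    mul_left_comm (C _) X, add_assoc 1, add_assoc 1, ← mul_add, ← mul_add,
    Finset.mul_sum _ _ (C (x (j + 1) - x j)), Finset.mul_sum _ _ (C (x (j + 1) - x j)),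
    ← Finset.sum_add_distrib, ← Finset.sum_add_distrib]
  congr 2
  refine Finset.sum_congr rfl fun k _ => ?_
  simp only [map_mul, map_sub, map_pow]; ring

/-! ### Interlacing: zeros are real and simple -/

/-- A bilinear form that measures interlacing: evaluated at a real point it is a Wronskian, and at
a point of the upper half-plane the imaginary part of `g * conj f`. -/
structure IsInterlacingForm (B : ℝ[X] →ₗ[ℝ] ℝ[X] →ₗ[ℝ] ℝ) : Prop where
  self : ∀ f, B f f = 0
  X_mul_X_mul : ∀ f g, 0 ≤ B f g → 0 ≤ B (X * f) (X * g)
  self_X_mul : ∀ f, 0 ≤ B f (X * f)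
  one_X : 0 < B 1 X

/-- The recursions build the next value, slope and curvature with positive coefficients, so
bilinearity propagates signs. The weak inequalities in `key` close the induction; only the strict
one is wanted. -/
theorem IsInterlacingForm.valuePoly_curvPoly_pos {B : ℝ[X] →ₗ[ℝ] ℝ[X] →ₗ[ℝ] ℝ}
    (hB : IsInterlacingForm B) (hx : StrictMono x) (hm : ∀ k, 0 < m k) (j : ℕ) :
    0 < B (valuePoly x m j) (curvPoly x m (j + 1)) := by
  have key : ∀ j,
      0 ≤ B (valuePoly x m j) (slopePoly x m j) ∧
      0 < B (valuePoly x m j) (curvPoly x m (j + 1)) ∧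
      0 ≤ B (slopePoly x m j) (curvPoly x m (j + 1)) ∧
      0 ≤ B (curvPoly x m (j + 1)) (X * valuePoly x m j) ∧
      0 ≤ B (curvPoly x m (j + 1)) (X * slopePoly x m j) ∧
      0 ≤ B (slopePoly x m j) (X * valuePoly x m j) := by
    intro j
    induction j with
    | zero =>
      have h : curvPoly x m 1 = m 0 • X := by
        rw [curvPoly_succ, valuePoly_zero]; simp [curvPoly]
      simp [h, valuePoly_zero, slopePoly_zero, hB.self, hB.one_X, hm 0]
    | succ j ih =>
      have hl : 0 < x (j + 1) - x j := sub_pos.2 (hx j.lt_succ_self)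
      have hf := valuePoly_succ (x := x) (m := m) j
      have hg := slopePoly_succ (x := x) (m := m) j
      have hh := curvPoly_succ (x := x) (m := m) (j + 1)
      have hm' := hm (j + 1)
      -- From here on only the three recursions, the induction hypothesis and the positivity of `l`
      -- and `μ` matter.
      generalize valuePoly x m (j + 1) = f' at *
      generalize slopePoly x m (j + 1) = g' at *
      generalize curvPoly x m (j + 1 + 1) = h' at *
      generalize valuePoly x m j = f at *
      generalize slopePoly x m j = g at *
      generalize curvPoly x m (j + 1) = h at *
      generalize x (j + 1) - x j = l at *
      generalize m (j + 1) = μ at *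
      obtain ⟨fg, fh, gh, hXf, hXg, gXf⟩ := ih
      have gg' : 0 ≤ B g g' := by
        rw [hg]; simp only [map_add, map_smul, smul_eq_mul, hB.self]; positivity
      have fg' : 0 ≤ B f g' := by
        rw [hg]; simp only [map_add, map_smul, smul_eq_mul]; positivity
      have g'h : 0 ≤ B g' h := by
        rw [hg]
        simp only [map_add, map_smul, smul_eq_mul, LinearMap.add_apply, LinearMap.smul_apply,
          hB.self]
        positivity
      have f'g' : 0 ≤ B f' g' := by
        rw [hf]
        simp only [map_add, map_smul, smul_eq_mul, LinearMap.add_apply, LinearMap.smul_apply,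
          hB.self]
        positivity
      have f'h : 0 < B f' h := by
        rw [hf]
        simp only [map_add, map_smul, smul_eq_mul, LinearMap.add_apply, LinearMap.smul_apply]
        positivity
      have hXh := hB.self_X_mul h
      have hXg' : 0 ≤ B h (X * g') := by
        rw [hg]; simp only [mul_add, mul_smul_comm, map_add, map_smul, smul_eq_mul]; positivity
      have hXf' : 0 ≤ B h (X * f') := by
        rw [hf]; simp only [mul_add, mul_smul_comm, map_add, map_smul, smul_eq_mul]; positivity
      have g'Xf : 0 ≤ B g' (X * f) := by
        rw [hg]
        simp only [map_add, map_smul, smul_eq_mul, LinearMap.add_apply, LinearMap.smul_apply]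
        positivity
      have gXg := hB.self_X_mul g
      have g'Xg : 0 ≤ B g' (X * g) := by
        rw [hg]
        simp only [map_add, map_smul, smul_eq_mul, LinearMap.add_apply, LinearMap.smul_apply]
        positivity
      have g'Xg' := hB.self_X_mul g'
      have g'Xf' : 0 ≤ B g' (X * f') := by
        rw [hf]; simp only [mul_add, mul_smul_comm, map_add, map_smul, smul_eq_mul]; positivity
      have f'Xf' := hB.self_X_mul f'
      have XfXg := hB.X_mul_X_mul _ _ f'g'
      refine ⟨f'g', ?_, ?_, ?_, ?_, g'Xf'⟩ <;> rw [hh] <;>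
        simp only [map_add, map_smul, smul_eq_mul, LinearMap.add_apply, LinearMap.smul_apply,
          hB.self] <;> positivity
  exact (key j).2.1

/-- The Wronskian of two polynomials at `t`. -/
noncomputable def wronskianForm (t : ℝ) : ℝ[X] →ₗ[ℝ] ℝ[X] →ₗ[ℝ] ℝ :=
  LinearMap.mk₂ ℝ (fun f g => f.eval t * (derivative g).eval t - (derivative f).eval t * g.eval t)
    (fun _ _ _ => by simp; ring) (fun _ _ _ => by simp; ring) (fun _ _ _ => by simp; ring)
    (fun _ _ _ => by simp; ring)

theorem isInterlacingForm_wronskianForm (t : ℝ) : IsInterlacingForm (wronskianForm t) where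
  self f := by simp [wronskianForm]; ring
  X_mul_X_mul f g h := by
    simp only [wronskianForm, LinearMap.mk₂_apply] at h ⊢
    have := mul_nonneg (sq_nonneg t) h
    simp
    linarith
  self_X_mul f := by
    simp [wronskianForm]
    linarith [mul_self_nonneg (f.eval t)]
  one_X := by simp [wronskianForm]

/-- The imaginary part of `g * conj f` at `w`. -/
noncomputable def imForm (w : ℂ) : ℝ[X] →ₗ[ℝ] ℝ[X] →ₗ[ℝ] ℝ :=
  LinearMap.mk₂ ℝ (fun f g => (aeval w f).re * (aeval w g).im - (aeval w f).im * (aeval w g).re)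
    (fun _ _ _ => by simp; ring) (fun _ _ _ => by simp; ring) (fun _ _ _ => by simp; ring)
    (fun _ _ _ => by simp; ring)

theorem isInterlacingForm_imForm {w : ℂ} (hw : 0 < w.im) : IsInterlacingForm (imForm w) where
  self f := by simp [imForm]; ring
  X_mul_X_mul f g h := by
    simp only [imForm, LinearMap.mk₂_apply] at h ⊢
    have := mul_nonneg (add_nonneg (sq_nonneg w.re) (sq_nonneg w.im)) h
    simp
    linarith
  self_X_mul f := by
    have := mul_nonneg hw.le (add_nonneg (sq_nonneg (aeval w f).re) (sq_nonneg (aeval w f).im))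
    simp [imForm]
    linarith
  one_X := by simpa [imForm] using hw

theorem aeval_curvPoly_ne_zero (hx : StrictMono x) (hm : ∀ k, 0 < m k) (j : ℕ) {w : ℂ}
    (hw : w.im ≠ 0) : aeval w (curvPoly x m (j + 1)) ≠ 0 := by
  have upper : ∀ w : ℂ, 0 < w.im → aeval w (curvPoly x m (j + 1)) ≠ 0 := by
    intro w hw h
    have := (isInterlacingForm_imForm hw).valuePoly_curvPoly_pos hx hm j
    simp [imForm, h] at this
  rcases hw.lt_or_gt with hw | hw
  · intro h
    refine upper (starRingEnd ℂ w) (by simpa using hw) ?_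
    rw [aeval_conj, h, map_zero]
  · exact upper w hw

theorem derivative_curvPoly_ne_zero (hx : StrictMono x) (hm : ∀ k, 0 < m k) (j : ℕ) {t : ℝ}
    (ht : (curvPoly x m (j + 1)).eval t = 0) : (derivative (curvPoly x m (j + 1))).eval t ≠ 0 := by
  intro h
  have := (isInterlacingForm_wronskianForm t).valuePoly_curvPoly_pos hx hm j
  simp [wronskianForm, h, ht] at this

/-! ### Sign, degree and number of zeros -/

theorem eval_valuePoly_pos (hm : ∀ k, 0 < m k) {t : ℝ} (ht : 0 ≤ t) (j : ℕ) :
    0 < (valuePoly x m j).eval t := by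
  induction j using Nat.strong_induction_on with
  | _ j ih =>
    rw [valuePoly_eq]
    simp only [eval_add, eval_one, eval_mul, eval_X, eval_finsetSum, eval_C]
    have : 0 ≤ ∑ k ∈ Finset.range j, m k * (x j - x k) ^ 2 * (valuePoly x m k).eval t :=
      Finset.sum_nonneg fun k hk =>
        mul_nonneg (mul_nonneg (hm k).le (sq_nonneg _)) (ih k (Finset.mem_range.1 hk)).le
    positivity

theorem eval_curvPoly_pos (hm : ∀ k, 0 < m k) {t : ℝ} (ht : 0 < t) (j : ℕ) :
    0 < (curvPoly x m (j + 1)).eval t := by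
  simp only [curvPoly, eval_mul, eval_X, eval_finsetSum, eval_C]
  exact mul_pos ht (Finset.sum_pos (fun k _ => mul_pos (hm k) (eval_valuePoly_pos hm ht.le k))
    (by simp))

theorem natDegree_valuePoly_le (j : ℕ) : (valuePoly x m j).natDegree ≤ j := by
  induction j using Nat.strong_induction_on with
  | _ j ih =>
    rcases j with _ | j
    · simp [valuePoly_zero]
    rw [valuePoly_eq]
    refine (natDegree_add_le _ _).trans (max_le (by simp) ?_)
    refine natDegree_mul_le.trans ?_
    rw [natDegree_X, add_comm]
    refine Nat.succ_le_succ (natDegree_sum_le_of_forall_le _ _ fun k hk => ?_)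
    have hk := Finset.mem_range.1 hk
    exact (natDegree_C_mul_le _ _).trans ((ih k hk).trans (by omega))

/-- Only the last summand reaches the top degree, since `valuePoly x m k` has degree at most `k`. -/
theorem coeff_X_mul_sum (a : ℕ → ℝ) (j : ℕ) :
    (X * ∑ k ∈ Finset.range (j + 1), C (a k) * valuePoly x m k).coeff (j + 1) =
      a j * (valuePoly x m j).coeff j := by
  rw [coeff_X_mul, finsetSum_coeff, Finset.sum_range_succ, coeff_C_mul, Finset.sum_eq_zero,
    zero_add]
  intro k hk
  rw [coeff_C_mul, coeff_eq_zero_of_natDegree_lt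
    ((natDegree_valuePoly_le k).trans_lt (Finset.mem_range.1 hk)), mul_zero]

theorem coeff_valuePoly_pos (hx : StrictMono x) (hm : ∀ k, 0 < m k) (j : ℕ) :
    0 < (valuePoly x m j).coeff j := by
  induction j with
  | zero => simp [valuePoly_zero]
  | succ j ih =>
    rw [valuePoly_eq, coeff_add, coeff_X_mul_sum, coeff_one, if_neg (by omega), zero_add]
    have := sub_pos.2 (hx j.lt_succ_self)
    have := hm j
    positivity

theorem natDegree_curvPoly (hx : StrictMono x) (hm : ∀ k, 0 < m k) (j : ℕ) :
    (curvPoly x m (j + 1)).natDegree = j + 1 := by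
  refine natDegree_eq_of_le_of_coeff_ne_zero ?_ ?_
  · refine natDegree_mul_le.trans ?_
    rw [natDegree_X, add_comm]
    refine Nat.succ_le_succ (natDegree_sum_le_of_forall_le _ _ fun k hk => ?_)
    have hk := Finset.mem_range.1 hk
    exact (natDegree_C_mul_le _ _).trans ((natDegree_valuePoly_le k).trans (by omega))
  · rw [curvPoly, coeff_X_mul_sum]
    exact (mul_pos (hm j) (coeff_valuePoly_pos hx hm j)).ne'

theorem card_roots_curvPoly (hx : StrictMono x) (hm : ∀ k, 0 < m k) (j : ℕ) :
    (curvPoly x m (j + 1)).roots.toFinset.card = j + 1 := by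
  set Q := curvPoly x m (j + 1) with hQ
  have hdeg : Q.natDegree = j + 1 := natDegree_curvPoly hx hm j
  have hQ0 : Q ≠ 0 := by rintro h; simp [h] at hdeg
  have hnodup : Q.roots.Nodup := by
    rw [Multiset.nodup_iff_count_le_one]
    intro t
    rw [count_roots]
    by_contra! h
    obtain ⟨h1, h2⟩ := (one_lt_rootMultiplicity_iff_isRoot hQ0).1 h
    exact derivative_curvPoly_ne_zero hx hm j h1 h2
  have hsplit : Q.Splits := by
    refine Splits.of_splits_map_of_injective (algebraMap ℝ ℂ).injective (IsAlgClosed.splits _)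
      fun w hw => ?_
    have hw : aeval w Q = 0 := by
      rw [← eval_map_algebraMap]; exact (mem_roots'.1 hw).2
    have him : w.im = 0 := by
      by_contra h
      exact aeval_curvPoly_ne_zero hx hm j h hw
    exact ⟨w.re, Complex.ext (by simp) (by simp [him])⟩
  rw [Multiset.toFinset_card_of_nodup hnodup, ← hdeg]
  exact hsplit.natDegree_eq_card_roots.symm

theorem exists_strictMono_range_eq_zeros_curvPoly (hx : StrictMono x) (hm : ∀ k, 0 < m k) {n : ℕ}
    (hn : 0 < n) : ∃ lam : Fin n → ℝ, lam ⟨0, hn⟩ = 0 ∧ StrictMono lam ∧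
      {z : ℂ | aeval (-z) (curvPoly x m n) = 0} = Set.range (fun k => (lam k : ℂ)) := by
  obtain ⟨j, rfl⟩ : ∃ j, n = j + 1 := ⟨n - 1, by omega⟩
  set Q := curvPoly x m (j + 1) with hQ
  have hQ0 : Q ≠ 0 := by
    intro h
    have := natDegree_curvPoly hx hm j
    simp [← hQ, h] at this
  -- Negation passes from `w` back to `z = -w`; sorting `S` then gives `lam`.
  set S : Finset ℝ := Q.roots.toFinset.image Neg.neg with hS
  have hmem : ∀ r : ℝ, r ∈ S ↔ Q.eval (-r) = 0 := by
    intro r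
    simp [hS, hQ0, neg_eq_iff_eq_neg]
  have hcard : S.card = j + 1 := by
    rw [hS, Finset.card_image_of_injective _ neg_injective, card_roots_curvPoly hx hm]
  have h0 : (0 : ℝ) ∈ S := by simp [hmem, hQ, curvPoly]
  have hnonneg : ∀ r ∈ S, 0 ≤ r := by
    intro r hr
    by_contra! h
    exact (eval_curvPoly_pos (x := x) hm (neg_pos.2 h) j).ne' ((hmem r).1 hr)
  refine ⟨S.orderEmbOfFin hcard, ?_, (S.orderEmbOfFin hcard).strictMono, ?_⟩
  · rw [Finset.orderEmbOfFin_zero hcard hn]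
    exact le_antisymm (S.min'_le 0 h0) (hnonneg _ (S.min'_mem _))
  · have : Set.range (fun k => (S.orderEmbOfFin hcard k : ℂ)) = (fun r : ℝ => (r : ℂ)) '' S := by
      rw [← Finset.range_orderEmbOfFin S hcard, ← Set.range_comp]; rfl
    rw [this]
    ext z
    simp only [Set.mem_ofPred_eq, Set.mem_image, Finset.mem_coe, hmem]
    constructor
    · intro hz
      have him : z.im = 0 := by
        by_contra h
        exact aeval_curvPoly_ne_zero hx hm j (w := -z) (by simpa using h) hz
      have hre : (z.re : ℂ) = z := Complex.ext (by simp) (by simp [him])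
      refine ⟨z.re, ?_, hre⟩
      rw [← hre, ← Complex.ofReal_neg, ← Complex.coe_algebraMap, aeval_algebraMap_apply] at hz
      simpa using hz
    · rintro ⟨r, hr, rfl⟩
      rw [← Complex.ofReal_neg, ← Complex.coe_algebraMap, aeval_algebraMap_apply]
      simpa using hr

end

/-! ### Vanishing third distributional derivative -/

theorem deriv_quadratic (a b c : ℂ) :
    deriv (fun x : ℝ => a + b * x + c * x ^ 2) = fun x : ℝ => b + 2 * c * x := by
  funext x
  have h : HasDerivAt (fun x : ℝ => (x : ℂ)) 1 x := Complex.ofRealCLM.hasDerivAt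
  refine HasDerivAt.deriv ?_
  refine (((h.const_mul b).const_add a).add ((h.pow 2).const_mul c)).congr_deriv ?_
  simp; ring

theorem iteratedDeriv_two_quadratic (a b c : ℂ) :
    iteratedDeriv 2 (fun x : ℝ => a + b * x + c * x ^ 2) = fun _ => 2 * c := by
  rw [iteratedDeriv_succ, iteratedDeriv_one, deriv_quadratic]
  simpa using deriv_quadratic b (2 * c) 0

theorem iteratedDeriv_three_eq {f₀ f₁ f₂ f₃ : ℝ → ℂ} (h₀ : ∀ x, HasDerivAt f₀ (f₁ x) x)
    (h₁ : ∀ x, HasDerivAt f₁ (f₂ x) x) (h₂ : ∀ x, HasDerivAt f₂ (f₃ x) x) :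
    iteratedDeriv 3 f₀ = f₃ := by
  rw [iteratedDeriv_succ, iteratedDeriv_succ, iteratedDeriv_one, funext fun x => (h₀ x).deriv,
    funext fun x => (h₁ x).deriv, funext fun x => (h₂ x).deriv]

/-- A function with vanishing third derivative is its own quadratic interpolation. -/
theorem eq_interpolation_of_hasDerivAt {f₀ f₁ f₂ : ℝ → ℂ} (h₀ : ∀ x, HasDerivAt f₀ (f₁ x) x)
    (h₁ : ∀ x, HasDerivAt f₁ (f₂ x) x) (h₂ : ∀ x, HasDerivAt f₂ 0 x) (x : ℝ) :
    f₀ x = f₀ 0 + (-3 * f₀ 0 + 4 * f₀ 1 - f₀ 2) / 2 * x + (f₀ 0 - 2 * f₀ 1 + f₀ 2) / 2 * x ^ 2 := by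
  have hid (x : ℝ) : HasDerivAt (fun x : ℝ => (x : ℂ)) 1 x := Complex.ofRealCLM.hasDerivAt
  have const {f : ℝ → ℂ} (h : ∀ x, HasDerivAt f 0 x) (x : ℝ) : f x = f 0 :=
    is_const_of_deriv_eq_zero (fun x => (h x).differentiableAt) (fun x => (h x).deriv) x 0
  have e₁ (x : ℝ) : f₁ x = f₁ 0 + f₂ 0 * x := by
    have := const (f := fun x : ℝ => f₁ x - f₂ 0 * x) (fun x => by
      refine ((h₁ x).sub ((hid x).const_mul (f₂ 0))).congr_deriv ?_
      rw [const h₂ x]; ring) x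
    simp only [Complex.ofReal_zero] at this
    linear_combination this
  have e₀ (x : ℝ) : f₀ x = f₀ 0 + f₁ 0 * x + f₂ 0 / 2 * x ^ 2 := by
    have := const (f := fun x : ℝ => f₀ x - (f₁ 0 * x + f₂ 0 / 2 * (x : ℂ) ^ 2)) (fun x => by
      refine ((h₀ x).sub (((hid x).const_mul (f₁ 0)).add
        (((hid x).pow 2).const_mul (f₂ 0 / 2)))).congr_deriv ?_
      rw [e₁ x]; simp; ring) x
    simp only [Complex.ofReal_zero] at this
    linear_combination this
  have v₁ := e₀ 1
  have v₂ := e₀ 2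
  push_cast at v₁ v₂
  rw [e₀ x]
  linear_combination (-(2 : ℂ) * x + x ^ 2) * v₁ + ((x : ℂ) / 2 - x ^ 2 / 2) * v₂

/-- A continuous function whose third distributional derivative vanishes is quadratic. -/
theorem eq_quadratic_of_integral_eq_zero {u : ℝ → ℂ} (hu : Continuous u)
    (h : ∀ ψ : ℝ → ℂ, ContDiff ℝ ∞ ψ → HasCompactSupport ψ →
      ∫ x, u x * iteratedDeriv 3 ψ x = 0) :
    ∃ a b c : ℂ, ∀ x : ℝ, u x = a + b * x + c * x ^ 2 := by
  let L := ContinuousLinearMap.lsmul ℝ ℝ (E := ℂ)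
  -- The interpolation formula involves only the values at 0, 1, 2 and `x`, so it survives the
  -- pointwise limit of the mollifications.
  have mollified (ρ : ContDiffBump (0 : ℝ)) (x : ℝ) :
      let v := convolution (ρ.normed volume) u L volume
      v x = v 0 + (-3 * v 0 + 4 * v 1 - v 2) / 2 * x + (v 0 - 2 * v 1 + v 2) / 2 * x ^ 2 := by
    have hρ : ContDiff ℝ ∞ (ρ.normed volume) := ρ.contDiff_normed
    have hc : HasCompactSupport (ρ.normed volume) := ρ.hasCompactSupport_normed
    have hρ₁ : ContDiff ℝ ∞ (deriv (ρ.normed volume)) := (contDiff_infty_iff_deriv.1 hρ).2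
    have hρ₂ := (contDiff_infty_iff_deriv.1 hρ₁).2
    have d {f : ℝ → ℝ} (hf : ContDiff ℝ ∞ f) (x : ℝ) : HasDerivAt f (deriv f x) x :=
      (contDiff_infty_iff_deriv.1 hf).1.differentiableAt.hasDerivAt
    have D {f : ℝ → ℝ} (hf : ContDiff ℝ ∞ f) (hc : HasCompactSupport f) (x : ℝ) :
        HasDerivAt (convolution f u L volume) (convolution (deriv f) u L volume x) x :=
      hc.hasDerivAt_convolution_left L (hf.of_le (by simp)) hu.locallyIntegrable x
    refine eq_interpolation_of_hasDerivAt (D hρ hc) (D hρ₁ hc.deriv) (fun y => ?_) x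
    convert D hρ₂ hc.deriv.deriv y using 1
    have dc {f : ℝ → ℝ} (hf : ContDiff ℝ ∞ f) (x : ℝ) :
        HasDerivAt (fun x => (f (y - x) : ℂ)) (-(deriv f (y - x)) : ℂ) x := by
      have := ((d hf (y - x)).comp_const_sub y x).ofReal_comp
      simpa using this
    -- The minus sign cancels the `(-1)³` from differentiating the reflected bump three times.
    have key := h (fun x => -(ρ.normed volume (y - x) : ℂ)) ?_ ?_
    · rw [iteratedDeriv_three_eq (fun x => (dc hρ x).fun_neg) (fun x => (dc hρ₁ x).fun_neg.fun_neg)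
        (fun x => (dc hρ₂ x).fun_neg.fun_neg.fun_neg)] at key
      rw [convolution_lsmul_swap, ← key]
      refine integral_congr_ae (.of_forall fun t => ?_)
      simp [mul_comm]
    · exact (Complex.ofRealCLM.contDiff.comp (hρ.comp (contDiff_const.sub contDiff_id))).neg
    · have : HasCompactSupport (fun x => ρ.normed volume (y - x)) :=
        hc.comp_homeomorph (Homeomorph.subLeft y)
      exact (this.comp_left (g := fun r : ℝ => -(r : ℂ)) (by simp))
  let ρ : ℕ → ContDiffBump (0 : ℝ) := fun i =>
    ⟨1 / (i + 1), 2 * (1 / (i + 1)), by positivity, by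
      have : (0 : ℝ) < 1 / (i + 1) := by positivity
      linarith⟩
  have hρ : Tendsto (fun i => (ρ i).rOut) atTop (𝓝 0) := by
    simpa [ρ] using (tendsto_one_div_add_atTop_nhds_zero_nat (𝕜 := ℝ)).const_mul 2
  have lim (x : ℝ) := ContDiffBump.convolution_tendsto_right_of_continuous (μ := volume) hρ hu x
  refine ⟨u 0, (-3 * u 0 + 4 * u 1 - u 2) / 2, (u 0 - 2 * u 1 + u 2) / 2, fun x =>
    tendsto_nhds_unique (lim x) ?_⟩
  rw [funext fun i => mollified (ρ i) x]
  exact ((lim 0).add ((((((lim 0).const_mul (-3)).add ((lim 1).const_mul 4)).sub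
    (lim 2)).div_const 2).mul_const _)).add
    (((((lim 0).sub ((lim 1).const_mul 2)).add (lim 2)).div_const 2).mul_const _)

/-! ### Fundamental solution and representation of solutions -/

/-- The function `(x - a)₊²`. -/
noncomputable def kink (a x : ℝ) : ℂ := ((max (x - a) 0 : ℝ) : ℂ) ^ 2

theorem continuous_kink (a : ℝ) : Continuous (kink a) := by unfold kink; fun_prop

theorem kink_of_le {a x : ℝ} (h : x ≤ a) : kink a x = 0 := by simp [kink, h]

theorem kink_of_ge {a x : ℝ} (h : a ≤ x) : kink a x = ((x : ℂ) - a) ^ 2 := by simp [kink, h]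

theorem hasCompactSupport_iteratedDeriv {ψ : ℝ → ℂ} (hc : HasCompactSupport ψ) (n : ℕ) :
    HasCompactSupport (iteratedDeriv n ψ) := by
  induction n with
  | zero => simpa using hc
  | succ n ih => rw [iteratedDeriv_succ]; exact ih.deriv

theorem continuous_iteratedDeriv {ψ : ℝ → ℂ} (hψ : ContDiff ℝ ∞ ψ) (n : ℕ) :
    Continuous (iteratedDeriv n ψ) :=
  hψ.continuous_iteratedDeriv n (by exact_mod_cast le_top)

theorem hasDerivAt_iteratedDeriv {ψ : ℝ → ℂ} (hψ : ContDiff ℝ ∞ ψ) (n : ℕ) (x : ℝ) :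
    HasDerivAt (iteratedDeriv n ψ) (iteratedDeriv (n + 1) ψ x) x := by
  rw [iteratedDeriv_succ]
  exact ((hψ.differentiable_iteratedDeriv n (by exact_mod_cast WithTop.coe_lt_top _)) x).hasDerivAt

theorem integrable_mul_iteratedDeriv {u ψ : ℝ → ℂ} (hu : Continuous u) (hψ : ContDiff ℝ ∞ ψ)
    (hc : HasCompactSupport ψ) (n : ℕ) : Integrable fun x => u x * iteratedDeriv n ψ x :=
  (hu.mul (continuous_iteratedDeriv hψ n)).integrable_of_hasCompactSupport
    (hasCompactSupport_iteratedDeriv hc n).mul_left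

theorem integral_iteratedDeriv_three {ψ : ℝ → ℂ} (hψ : ContDiff ℝ ∞ ψ)
    (hc : HasCompactSupport ψ) : ∫ x, iteratedDeriv 3 ψ x = 0 := by
  refine integral_eq_zero_of_hasDerivAt_of_integrable (hasDerivAt_iteratedDeriv hψ 2) ?_ ?_ <;>
    exact (continuous_iteratedDeriv hψ _).integrable_of_hasCompactSupport
      (hasCompactSupport_iteratedDeriv hc _)

/-- The third derivative of `(x - a)₊²` is `2 δ_a`. On `(a, ∞)` the integrand has an explicit
primitive, whose value at `a` is `2 ψ a`. -/
theorem integral_kink_mul {ψ : ℝ → ℂ} (hψ : ContDiff ℝ ∞ ψ) (hc : HasCompactSupport ψ) (a : ℝ) :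
    ∫ x, kink a x * iteratedDeriv 3 ψ x = -2 * ψ a := by
  have h1 : ∫ x, kink a x * iteratedDeriv 3 ψ x =
      ∫ x in Set.Ioi a, ((x : ℂ) - a) ^ 2 * iteratedDeriv 3 ψ x := by
    rw [← integral_indicator measurableSet_Ioi]
    refine integral_congr_ae (.of_forall fun x => ?_)
    by_cases hx : a < x
    · simp [hx, kink_of_ge hx.le]
    · simp [hx, kink_of_le (not_lt.1 hx)]
  have hcont : Continuous fun x : ℝ => (x : ℂ) - a := by fun_prop
  have hcs : HasCompactSupport fun x : ℝ => ((x : ℂ) - a) ^ 2 * iteratedDeriv 2 ψ x -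
      2 * ((x : ℂ) - a) * iteratedDeriv 1 ψ x + 2 * ψ x :=
    ((hasCompactSupport_iteratedDeriv hc 2).mul_left.sub
      (hasCompactSupport_iteratedDeriv hc 1).mul_left).add hc.mul_left
  rw [h1, integral_Ioi_of_hasDerivAt_of_tendsto' (m := 0)
    (f := fun x : ℝ => ((x : ℂ) - a) ^ 2 * iteratedDeriv 2 ψ x -
      2 * ((x : ℂ) - a) * iteratedDeriv 1 ψ x + 2 * ψ x)]
  · simp
  · intro x _
    have hid : HasDerivAt (fun x : ℝ => (x : ℂ) - a) 1 x :=
      (Complex.ofRealCLM.hasDerivAt (x := x)).sub_const _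
    have h0 := hasDerivAt_iteratedDeriv hψ 0 x
    rw [iteratedDeriv_zero] at h0
    refine ((((hid.pow 2).mul (hasDerivAt_iteratedDeriv hψ 2 x)).sub
      ((hid.const_mul 2).mul (hasDerivAt_iteratedDeriv hψ 1 x))).add
      (h0.const_mul 2)).congr_deriv ?_
    simp; ring
  · exact (integrable_mul_iteratedDeriv (hcont.pow 2) hψ hc 3).integrableOn
  · rw [hasCompactSupport_iff_eventuallyEq, coclosedCompact_eq_cocompact] at hcs
    exact (hcs.filter_mono atTop_le_cocompact).tendsto

theorem integral_discreteMass {n : ℕ} (x m : ℕ → ℝ) (hm : ∀ k, 0 < m k) (f : ℝ → ℂ) :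
    ∫ t, f t ∂(discreteMass (fun k : Fin n => x k) (fun k : Fin n => m k)) =
      ∑ k ∈ Finset.range n, 2 * m k * f (x k) := by
  rw [discreteMass, integral_finsetSum_measure]
  · rw [Finset.sum_range]
    refine Finset.sum_congr rfl fun k _ => ?_
    rw [integral_smul_measure, integral_dirac, ENNReal.toReal_ofReal (by have := hm k; positivity)]
    simp
  · exact fun k _ => (integrable_dirac (by simp)).smul_measure ENNReal.ofReal_ne_top

theorem integral_sum_kink_mul {ψ : ℝ → ℂ} (hψ : ContDiff ℝ ∞ ψ) (hc : HasCompactSupport ψ)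
    (x : ℕ → ℝ) (d : ℕ → ℂ) (n : ℕ) :
    ∫ t, (∑ k ∈ Finset.range n, d k * kink (x k) t) * iteratedDeriv 3 ψ t =
      -∑ k ∈ Finset.range n, 2 * d k * ψ (x k) := by
  simp_rw [Finset.sum_mul, mul_assoc]
  rw [integral_finsetSum]
  · rw [← Finset.sum_neg_distrib]
    refine Finset.sum_congr rfl fun k _ => ?_
    rw [integral_const_mul, integral_kink_mul hψ hc]; ring
  · exact fun k _ => (integrable_mul_iteratedDeriv (continuous_kink _) hψ hc 3).const_mul _

theorem continuous_sum_kink (x : ℕ → ℝ) (d : ℕ → ℂ) (n : ℕ) :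
    Continuous fun t => ∑ k ∈ Finset.range n, d k * kink (x k) t :=
  continuous_finsetSum _ fun _ _ => continuous_const.mul (continuous_kink _)

/-- Adding the kinks to `φ` cancels the point masses and leaves a function with zero third
distributional derivative. -/
theorem IsSolution.exists_eq_quadratic_sub {x m : ℕ → ℝ} (hm : ∀ k, 0 < m k) {n : ℕ} {z : ℂ}
    {φ : ℝ → ℂ} (h : IsSolution (discreteMass (fun k : Fin n => x k) (fun k : Fin n => m k)) z φ) :
    ∃ a b c : ℂ, ∀ t : ℝ, φ t = a + b * t + c * t ^ 2 -
      ∑ k ∈ Finset.range n, z * m k * φ (x k) * kink (x k) t := by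
  have hs := continuous_sum_kink x (fun k => z * m k * φ (x k)) n
  obtain ⟨a, b, c, H⟩ := eq_quadratic_of_integral_eq_zero (h.continuous.add hs)
    fun ψ hψ hc => by
      simp_rw [Pi.add_apply, add_mul]
      rw [integral_add (integrable_mul_iteratedDeriv h.continuous hψ hc 3)
        (integrable_mul_iteratedDeriv hs hψ hc 3), integral_sum_kink_mul hψ hc,
        h.weak_eq ψ hψ hc, integral_discreteMass x m hm, Finset.mul_sum, ← sub_eq_add_neg,
        ← Finset.sum_sub_distrib]
      exact Finset.sum_eq_zero fun k _ => by ring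
  exact ⟨a, b, c, fun t => eq_sub_of_add_eq (H t)⟩

theorem isSolution_of_eq_const_sub {x m : ℕ → ℝ} (hm : ∀ k, 0 < m k) {n : ℕ} {z a : ℂ}
    {φ : ℝ → ℂ} (h : ∀ t, φ t = a - ∑ k ∈ Finset.range n, z * m k * φ (x k) * kink (x k) t) :
    IsSolution (discreteMass (fun k : Fin n => x k) (fun k : Fin n => m k)) z φ := by
  have hs := continuous_sum_kink x (fun k => z * m k * φ (x k)) n
  refine ⟨?_, fun ψ hψ hc => ?_⟩
  · rw [funext h]; exact continuous_const.sub hs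
  · have : ∫ t, φ t * iteratedDeriv 3 ψ t =
        ∫ t, (a * iteratedDeriv 3 ψ t -
          (∑ k ∈ Finset.range n, z * m k * φ (x k) * kink (x k) t) * iteratedDeriv 3 ψ t) :=
      integral_congr_ae (.of_forall fun t => by
        change φ t * _ = _
        rw [h t, sub_mul])
    rw [this, integral_sub (integrable_mul_iteratedDeriv continuous_const hψ hc 3)
      (integrable_mul_iteratedDeriv hs hψ hc 3), integral_const_mul,
      integral_iteratedDeriv_three hψ hc, integral_sum_kink_mul hψ hc,
      integral_discreteMass x m hm, Finset.mul_sum]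
    simp only [mul_zero, zero_sub, neg_neg]
    exact Finset.sum_congr rfl fun k _ => by ring

/-! ### Boundary conditions and the eigenvalue equation -/

theorem neumannLike_iff {x : ℕ → ℝ} (hx : StrictMono x) {n : ℕ} {a b c : ℂ} {d : ℕ → ℂ}
    {φ : ℝ → ℂ}
    (h : ∀ t : ℝ, φ t = a + b * t + c * t ^ 2 - ∑ k ∈ Finset.range n, d k * kink (x k) t) :
    NeumannLike φ ↔ b = 0 ∧ c = 0 ∧ ∑ k ∈ Finset.range n, d k = 0 := by
  have left : ∀ᶠ t in atBot, φ =ᶠ[𝓝 t] fun t : ℝ => a + b * t + c * t ^ 2 := by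
    filter_upwards [eventually_lt_atBot (x 0)] with t ht
    filter_upwards [eventually_lt_nhds ht] with s hs
    rw [h s, Finset.sum_eq_zero, sub_zero]
    exact fun k _ => by rw [kink_of_le (hs.le.trans (hx.monotone k.zero_le)), mul_zero]
  have right : ∀ᶠ t in atTop, φ =ᶠ[𝓝 t] fun t : ℝ =>
      (a - ∑ k ∈ Finset.range n, d k * x k ^ 2) + (b + 2 * ∑ k ∈ Finset.range n, d k * x k) * t +
        (c - ∑ k ∈ Finset.range n, d k) * t ^ 2 := by
    filter_upwards [eventually_gt_atTop (x n)] with t ht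
    filter_upwards [eventually_gt_nhds ht] with s hs
    have : ∑ k ∈ Finset.range n, d k * kink (x k) s =
        ∑ k ∈ Finset.range n, (d k * x k ^ 2 - d k * x k * (2 * s) + d k * s ^ 2) := by
      refine Finset.sum_congr rfl fun k hk => ?_
      rw [kink_of_ge ((hx.monotone (Finset.mem_range.1 hk).le).trans hs.le)]; ring
    rw [h s, this, Finset.sum_add_distrib, Finset.sum_sub_distrib, ← Finset.sum_mul,
      ← Finset.sum_mul]
    ring
  have left₁ : deriv φ =ᶠ[atBot] fun t : ℝ => b + 2 * c * t :=
    left.mono fun t ht => by rw [ht.deriv_eq, deriv_quadratic]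
  have left₂ : iteratedDeriv 2 φ =ᶠ[atBot] fun _ => 2 * c :=
    left.mono fun t ht => by rw [ht.iteratedDeriv_eq, iteratedDeriv_two_quadratic]
  have right₂ : iteratedDeriv 2 φ =ᶠ[atTop] fun _ => 2 * (c - ∑ k ∈ Finset.range n, d k) :=
    right.mono fun t ht => by rw [ht.iteratedDeriv_eq, iteratedDeriv_two_quadratic]
  constructor
  · rintro ⟨h₁, h₂, h₃⟩
    -- The curvature must go first: only then is `φ'` constant near `-∞`.
    have hc : c = 0 := by
      simpa using tendsto_nhds_unique (tendsto_const_nhds.congr' left₂.symm) h₂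
    subst hc
    have hb : b = 0 := by
      refine tendsto_nhds_unique (tendsto_const_nhds.congr' ?_) h₁
      filter_upwards [left₁] with t ht
      simp [ht]
    refine ⟨hb, rfl, ?_⟩
    simpa using tendsto_nhds_unique (tendsto_const_nhds.congr' right₂.symm) h₃
  · rintro ⟨rfl, rfl, hd⟩
    simp only [mul_zero, zero_mul, add_zero, hd, sub_zero] at left₁ left₂ right₂
    exact ⟨tendsto_const_nhds.congr' left₁.symm, tendsto_const_nhds.congr' left₂.symm,
      tendsto_const_nhds.congr' right₂.symm⟩

theorem sum_mul_kink {x : ℕ → ℝ} (hx : StrictMono x) (d : ℕ → ℂ) {j n : ℕ} (hj : j ≤ n) :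
    ∑ k ∈ Finset.range n, d k * kink (x k) (x j) =
      ∑ k ∈ Finset.range j, d k * ((x j : ℂ) - x k) ^ 2 := by
  rw [← Finset.sum_subset (Finset.range_mono hj)]
  · exact Finset.sum_congr rfl fun k hk => by
      rw [kink_of_ge (hx.monotone (Finset.mem_range.1 hk).le)]
  · intro k _ hk
    rw [kink_of_le (hx.monotone (by simpa using hk)), mul_zero]

theorem aeval_valuePoly (x m : ℕ → ℝ) (z : ℂ) (j : ℕ) : aeval (-z) (valuePoly x m j) =
    1 - ∑ k ∈ Finset.range j,
      z * m k * aeval (-z) (valuePoly x m k) * ((x j : ℂ) - x k) ^ 2 := by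
  rw [valuePoly_eq]
  simp only [map_add, map_one, map_mul, aeval_X, map_sum, aeval_C, Complex.coe_algebraMap,
    map_pow, map_sub]
  rw [Finset.mul_sum, sub_eq_add_neg, ← Finset.sum_neg_distrib]
  exact congrArg _ (Finset.sum_congr rfl fun k _ => by ring)

theorem aeval_curvPoly (x m : ℕ → ℝ) (z : ℂ) (n : ℕ) : aeval (-z) (curvPoly x m n) =
    -∑ k ∈ Finset.range n, z * m k * aeval (-z) (valuePoly x m k) := by
  simp only [curvPoly, map_mul, aeval_X, map_sum, aeval_C, Complex.coe_algebraMap]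
  rw [Finset.mul_sum, ← Finset.sum_neg_distrib]
  exact Finset.sum_congr rfl fun k _ => by ring

/-- The eigenvalues of the discrete cubic string are the negatives of the zeros of `curvPoly`. -/
theorem isEigenvalue_iff {x m : ℕ → ℝ} (hx : StrictMono x) (hm : ∀ k, 0 < m k) (n : ℕ) (z : ℂ) :
    IsEigenvalue (discreteMass (fun k : Fin n => x k) (fun k : Fin n => m k)) z ↔
      aeval (-z) (curvPoly x m n) = 0 := by
  rw [aeval_curvPoly, neg_eq_zero]
  constructor
  · rintro ⟨φ, hφ, hsol, hbd⟩
    obtain ⟨a, b, c, h⟩ := hsol.exists_eq_quadratic_sub hm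
    obtain ⟨rfl, rfl, hsum⟩ := (neumannLike_iff hx h).1 hbd
    simp only [zero_mul, add_zero] at h
    -- At `x j` only the kinks of earlier masses are nonzero, so the values obey the recursion of
    -- `valuePoly`, scaled by `a`.
    have value : ∀ j < n, φ (x j) = a * aeval (-z) (valuePoly x m j) := by
      intro j
      induction j using Nat.strong_induction_on with
      | _ j ih =>
        intro hj
        rw [h, sum_mul_kink hx _ hj.le, aeval_valuePoly, mul_sub, mul_one, Finset.mul_sum]
        refine congrArg _ (Finset.sum_congr rfl fun k hk => ?_)
        have hk := Finset.mem_range.1 hk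
        rw [ih k hk (hk.trans hj)]; ring
    have ha : a ≠ 0 := by
      rintro rfl
      refine hφ (funext fun t => ?_)
      rw [h, Finset.sum_eq_zero]
      · simp
      · intro k hk
        rw [value k (Finset.mem_range.1 hk)]; simp
    refine (mul_eq_zero.1 (?_ : a * _ = 0)).resolve_left ha
    rw [← hsum, Finset.mul_sum]
    refine Finset.sum_congr rfl fun k hk => ?_
    rw [value k (Finset.mem_range.1 hk)]; ring
  · intro hsum
    let φ : ℝ → ℂ := fun t => 1 -
      ∑ k ∈ Finset.range n, z * m k * aeval (-z) (valuePoly x m k) * kink (x k) t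
    have value : ∀ j ≤ n, φ (x j) = aeval (-z) (valuePoly x m j) := by
      intro j hj
      rw [aeval_valuePoly, ← sum_mul_kink hx _ hj]
    refine ⟨φ, fun h => ?_, isSolution_of_eq_const_sub hm (a := 1) fun t => ?_,
      (neumannLike_iff hx (a := 1) (b := 0) (c := 0)
        (d := fun k => z * m k * aeval (-z) (valuePoly x m k)) fun t => ?_).2 ⟨rfl, rfl, hsum⟩⟩
    · have h0 := value 0 n.zero_le
      simp [h, valuePoly_zero] at h0
    · refine congrArg (1 - ·) (Finset.sum_congr rfl fun k hk => ?_)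
      rw [value k (Finset.mem_range.1 hk).le]
    · simp [φ]

/-- The recursions are indexed by `ℕ`. Past the last point the sequence continues in unit steps; the
empty case has no last point. -/
theorem exists_strictMono_extension {n : ℕ} (x : Fin n → ℝ) (hx : StrictMono x) :
    ∃ y : ℕ → ℝ, StrictMono y ∧ x = fun k : Fin n => y k := by
  rcases n with _ | n
  · exact ⟨fun k => k, Nat.strictMono_cast, funext fun k => k.elim0⟩
  refine ⟨fun k => x (Fin.ofNat (n + 1) (min k n)) + (k - n : ℕ), ?_, ?_⟩
  · refine strictMono_nat_of_lt_succ fun k => ?_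
    rcases lt_or_ge k n with hk | hk
    · rw [min_eq_left hk.le, min_eq_left hk, Nat.sub_eq_zero_of_le hk.le, Nat.sub_eq_zero_of_le hk]
      gcongr
      refine hx (Fin.mk_lt_mk.2 ?_)
      rw [Nat.mod_eq_of_lt (by omega), Nat.mod_eq_of_lt (by omega)]
      omega
    · rw [min_eq_right hk, min_eq_right (hk.trans k.le_succ)]
      gcongr
      omega
  · funext k
    have hk : (k : ℕ) ≤ n := Nat.lt_succ_iff.1 k.2
    simp [min_eq_left hk, Nat.sub_eq_zero_of_le hk]

end CubicString

theorem mainTheorem3 (n : ℕ) (hn : 0 < n) (x m : Fin n → ℝ) (hx : StrictMono x)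
    (hm : ∀ k, 0 < m k) :
    ∃ lam : Fin n → ℝ, lam ⟨0, hn⟩ = 0 ∧ StrictMono lam ∧
      {z : ℂ | CubicString.IsEigenvalue (CubicString.discreteMass x m) z} =
        Set.range (fun k => (lam k : ℂ)) := by
  obtain ⟨y, hy, rfl⟩ := CubicString.exists_strictMono_extension x hx
  -- Any positive padding would do: only the first `n` masses enter the measure.
  let μ : ℕ → ℝ := fun k => if h : k < n then m ⟨k, h⟩ else 1
  have hμ : ∀ k, 0 < μ k := by
    intro k
    by_cases h : k < n
    · simpa [μ, h] using hm _
    · simp [μ, h]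
  have hmμ : m = fun k : Fin n => μ k := by funext k; simp [μ]
  simp_rw [hmμ, CubicString.isEigenvalue_iff hy hμ]
  exact CubicString.exists_strictMono_range_eq_zeros_curvPoly hy hμ hn
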